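/- Let $G=(V,E)$ be a finite connected simple graph and $h\ge 0$ an integer. A set $F\subseteq E$ is an *$h$-extra edge-cut* if $G-F$ is disconnected and every component of $G-F$ has more than $h$ vertices; $\lambda^{(h)}(G)$ is the minimum size of an $h$-extra edge-cut, if one exists. Let $\xi_h(G)$ be the minimum, over all $X\subset V$ with $|X|=h+1$ and $G[X]$ connected, of the number of edges with exactly one end in $X$. The graph $G$ is *super-$\lambda^{(h)}$* if it is connected, $\lambda^{(h)}(G)$ exists and equals $\xi_h(G)$, and for every $h$-extra edge-cut $F$ with $|F|=\lambda^{(h)}(G)$ some component of $G-F$ has exactly $h+1$ vertices. For a super-$\lambda^{(h)}$ graph $G$, $\rho^{(h)}(G)$ is the maximum integer $m$ such that $G-F$ is super-$\lambda^{(h)}$ for every $F\subseteq E$ with $|F|\le m$. Write $\lambda',\lambda'',\rho'$ for $\lambda^{(1)},\lambda^{(2)},\rho^{(1)}$. The following graphs have as vertices the binary strings $u_{n-1}\cdots u_1u_0$ of length $n$; each vertex $u$ has exactly one neighbour along each dimension $d\in\{0,\dots,n-1\}$. - *Hypercube* $Q_n$: complement $u_d$. - *Twisted cube* $TQ_n$: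 if $d$ is odd, $d+1<n$ and $u_{d-1}\oplus\cdots\oplus u_0=0$, complement both $u_{d+1}$ and $u_d$; otherwise complement only $u_d$. (For odd $n$ this is the usual twisted cube; for even $n$ it is the Cartesian product $TQ_{n-1}\times K_2$.) - *Crossed cube* $CQ_n$: $u$ and $v$ are adjacent along dimension $d$ iff $u_i=v_i$ for $i>d$, $u_d\ne v_d$, $u_{d-1}=v_{d-1}$ if $d$ is odd, and $(u_{2i+1}u_{2i},v_{2i+1}v_{2i})\in\{(00,00),(10,10),(01,11),(11,01)\}$ for $0\le i<\lfloor d/2\rfloor$. - *Möbius cubes* $MQ_n$ ($0$-$MQ_n$ and $1$-$MQ_n$): complement only $u_d$ if $u_{d+1}=0$, and complement all of $u_d,u_{d-1},\dots,u_0$ if $u_{d+1}=1$, where $u_n:=0$ for $0$-$MQ_n$ and $u_n:=1$ for $1$-$MQ_n$. - *Locally twisted cube* $LTQ_n$: complement $u_d$ and, if $d\ge 2$, also replace $u_{d-1}$ by $u_{d-1}\oplus u_0$. **Corollary 4.5.** Let $n\ge 5$ and let $G_n$ be any of $Q_n$, $TQ_n$, $CQ_n$, $MQ_n$ (either of the two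 Möbius cubes) and $LTQ_n$. Then $G_n$ is super-$\lambda''$, $G_n$ is super-$\lambda'$, and $\rho'(G_n)=n-1$. -/

import Mathlib

/-! Finite simple graphs: extra edge-connectivity and persistence; hypercube-like networks. -/

namespace CubeNetworks

section ExtraEdgeConnectivity

variable {V : Type*}

/-- `F ⊆ E(G)` is an `h`-extra edge-cut of `G`: the graph `G - F` is disconnected and every
connected component of `G - F` has more than `h` vertices. -/
def IsExtraEdgeCut (G : SimpleGraph V) (h : ℕ) (F : Finset (Sym2 V)) : Prop :=
  (F : Set (Sym2 V)) ⊆ G.edgeSet ∧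
  ¬ (G.deleteEdges (F : Set (Sym2 V))).Connected ∧
  ∀ c : (G.deleteEdges (F : Set (Sym2 V))).ConnectedComponent, (h : ℕ∞) < c.supp.encard

/-- The `h`-extra edge-connectivity `λ^(h)(G)`: the minimum size of an `h`-extra edge-cut.
The value is `⊤` exactly when there is no `h`-extra edge-cut, that is, when `λ^(h)(G)` does
not exist. -/
noncomputable def extraEdgeConnectivity (G : SimpleGraph V) (h : ℕ) : ℕ∞ :=
  ⨅ (F : Finset (Sym2 V)) (_ : IsExtraEdgeCut G h F), (F.card : ℕ∞)

/-- The set `E_G(X)` of the edges of `G` with one end in `X` and the other outside `X`. -/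
def edgesLeaving (G : SimpleGraph V) (X : Set V) : Set (Sym2 V) :=
  {e | ∃ x ∈ X, ∃ y ∉ X, G.Adj x y ∧ e = s(x, y)}

/-- `ξ_h(G)`: the minimum of `d_G(X) = |E_G(X)|` over all sets `X` of `h + 1` vertices that
induce a connected subgraph (`⊤` if there is no such `X`). -/
noncomputable def minExtraDegree (G : SimpleGraph V) (h : ℕ) : ℕ∞ :=
  ⨅ (X : Finset V) (_ : X.card = h + 1 ∧ (G.induce (X : Set V)).Connected),
    (edgesLeaving G (X : Set V)).encard

/-- `G` is `λ^(h)`-optimal: `λ^(h)(G)` exists and equals `ξ_h(G)`. -/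
def IsExtraOptimal (G : SimpleGraph V) (h : ℕ) : Prop :=
  extraEdgeConnectivity G h ≠ ⊤ ∧ extraEdgeConnectivity G h = minExtraDegree G h

/-- The (connected) graph `G` is super-`λ^(h)`: it is `λ^(h)`-optimal, and every minimum
`h`-extra edge-cut `F` isolates a connected subgraph of order `h + 1`, that is, some connected
component of `G - F` has exactly `h + 1` vertices. -/
def IsSuperExtra (G : SimpleGraph V) (h : ℕ) : Prop :=
  G.Connected ∧ IsExtraOptimal G h ∧
  ∀ F : Finset (Sym2 V), IsExtraEdgeCut G h F → (F.card : ℕ∞) = extraEdgeConnectivity G h →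
    ∃ c : (G.deleteEdges (F : Set (Sym2 V))).ConnectedComponent, c.supp.encard = (h + 1 : ℕ)

/-- `ρ^(h)(G) = m`: the number `m` is the maximum integer such that `G - F` is super-`λ^(h)`
for every `F ⊆ E(G)` with `|F| ≤ m`. -/
def HasPersistence (G : SimpleGraph V) (h m : ℕ) : Prop :=
  IsGreatest {m : ℕ | ∀ F : Finset (Sym2 V), (F : Set (Sym2 V)) ⊆ G.edgeSet → F.card ≤ m →
    IsSuperExtra (G.deleteEdges (F : Set (Sym2 V))) h} m

end ExtraEdgeConnectivity

section Cubes

/-- Binary strings `u_{n-1} … u_1 u_0` of length `n`; the bit `u_i` of `u` is `u i`. -/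
abbrev BitString (n : ℕ) : Type := Fin n → Bool

variable {n : ℕ}

/-- The positions in which the strings `u` and `v` differ are exactly the elements of `S`. -/
def DifferExactlyAt (u v : BitString n) (S : Set ℕ) : Prop :=
  ∀ i : Fin n, u i ≠ v i ↔ (i : ℕ) ∈ S

/-- The bit `u_i`, where positions `i ≥ n` beyond the string are given the value `c`. -/
def bitD (u : BitString n) (c : Bool) (i : ℕ) : Bool :=
  if hi : i < n then u ⟨i, hi⟩ else c

/-- The parity of the number of ones among the bits of `u` in positions below `d`, as a bit:
`u_{d-1} ⊕ … ⊕ u_0`. -/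
def parityBelow (u : BitString n) (d : ℕ) : Bool :=
  decide (Odd (Finset.univ.filter fun i : Fin n => (i : ℕ) < d ∧ u i = true).card)

theorem DifferExactlyAt.symm {u v : BitString n} {S : Set ℕ} (h : DifferExactlyAt u v S) :
    DifferExactlyAt v u S := fun i => ne_comm.trans (h i)

theorem DifferExactlyAt.not_self {u : BitString n} {S : Set ℕ} {d : Fin n} (hd : (d : ℕ) ∈ S) :
    ¬ DifferExactlyAt u u S := fun h => (h d).2 hd rfl

theorem DifferExactlyAt.eq_of_not_mem {u v : BitString n} {S : Set ℕ}
    (h : DifferExactlyAt u v S) {i : Fin n} (hi : (i : ℕ) ∉ S) : u i = v i := by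
  by_contra hne
  exact hi ((h i).1 hne)

theorem DifferExactlyAt.bitD_eq {u v : BitString n} {S : Set ℕ} (h : DifferExactlyAt u v S)
    (c : Bool) {i : ℕ} (hi : i ∉ S) : bitD u c i = bitD v c i := by
  unfold bitD
  split
  · exact h.eq_of_not_mem hi
  · rfl

theorem DifferExactlyAt.parityBelow_eq {u v : BitString n} {S : Set ℕ}
    (h : DifferExactlyAt u v S) {d : ℕ} (hd : ∀ i < d, i ∉ S) :
    parityBelow u d = parityBelow v d := by
  unfold parityBelow
  have : (Finset.univ.filter fun i : Fin n => (i : ℕ) < d ∧ u i = true) =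
      (Finset.univ.filter fun i : Fin n => (i : ℕ) < d ∧ v i = true) := by
    ext i
    simp only [Finset.mem_filter, Finset.mem_univ, true_and]
    constructor
    · rintro ⟨h1, h2⟩
      exact ⟨h1, by rw [← h.eq_of_not_mem (hd i h1)]; exact h2⟩
    · rintro ⟨h1, h2⟩
      exact ⟨h1, by rw [h.eq_of_not_mem (hd i h1)]; exact h2⟩
  rw [this]

/-- The hypercube `Q_n`: two strings are adjacent iff they differ in exactly one position. -/
def hypercube (n : ℕ) : SimpleGraph (BitString n) where
  Adj u v := ∃ d : Fin n, DifferExactlyAt u v {(d : ℕ)}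
  symm := ⟨by
    rintro u v ⟨d, h⟩
    exact ⟨d, h.symm⟩⟩
  loopless := ⟨by
    rintro u ⟨d, h⟩
    exact DifferExactlyAt.not_self (d := d) (by simp) h⟩

open Classical in
/-- The positions flipped along the edge of dimension `d` at the vertex `u` of the twisted cube.
In odd dimension the positions `1, …, n-1` are grouped into pairs `(2j, 2j-1)`. An edge of
dimension `0` or `2j` flips just that bit. An edge of dimension `d = 2j-1` flips the bit `d` only
if `u_{2j-2} ⊕ … ⊕ u_0 = 1`, and both bits `2j` and `2j-1` if `u_{2j-2} ⊕ … ⊕ u_0 = 0`.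
In even dimension the position `n-1` is left unpaired, and the edge of dimension `n-1` flips just
that bit, so that `TQ_n` is the Cartesian product of `TQ_{n-1}` and `K_2`. -/
def twistedFlips (u : BitString n) (d : ℕ) : Set ℕ :=
  if Odd d ∧ d + 1 < n ∧ parityBelow u d = false then {d, d + 1} else {d}

theorem mem_twistedFlips_self (u : BitString n) (d : ℕ) : d ∈ twistedFlips u d := by
  unfold twistedFlips
  split <;> simp

theorem le_of_mem_twistedFlips {u : BitString n} {d i : ℕ} (h : i ∈ twistedFlips u d) :
    d ≤ i := by
  unfold twistedFlips at h
  split at h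
  · simp only [Set.mem_insert_iff, Set.mem_singleton_iff] at h
    omega
  · simp only [Set.mem_singleton_iff] at h
    omega

/-- The twisted cube `TQ_n`. -/
def twistedCube (n : ℕ) : SimpleGraph (BitString n) where
  Adj u v := ∃ d : Fin n, DifferExactlyAt u v (twistedFlips u d)
  symm := ⟨by
    rintro u v ⟨d, h⟩
    refine ⟨d, ?_⟩
    have hp : parityBelow u d = parityBelow v d :=
      h.parityBelow_eq fun i hi hmem => absurd (le_of_mem_twistedFlips hmem) (by omega)
    have : twistedFlips v d = twistedFlips u d := by
      unfold twistedFlips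
      rw [hp]
    rw [this]
    exact h.symm⟩
  loopless := ⟨by
    rintro u ⟨d, h⟩
    exact DifferExactlyAt.not_self (d := d) (mem_twistedFlips_self u d) h⟩

/-- The two-bit strings `x₁x₀` and `y₁y₀` are pair related:
`(x₁x₀, y₁y₀)` is one of `(00,00)`, `(10,10)`, `(01,11)`, `(11,01)`. -/
def PairRelated (x₁ x₀ y₁ y₀ : Bool) : Prop :=
  (x₁, x₀, y₁, y₀) ∈ ({(false, false, false, false), (true, false, true, false),
    (false, true, true, true), (true, true, false, true)} : Set (Bool × Bool × Bool × Bool))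

theorem PairRelated.symm {x₁ x₀ y₁ y₀ : Bool} (h : PairRelated x₁ x₀ y₁ y₀) :
    PairRelated y₁ y₀ x₁ x₀ := by
  revert h
  cases x₁ <;> cases x₀ <;> cases y₁ <;> cases y₀ <;> simp [PairRelated]

/-- The crossed cube `CQ_n`: `u` and `v` are adjacent iff for some position `d` they agree in all
positions above `d`, differ in position `d`, agree in position `d - 1` if `d` is odd, and the
pairs `u_{2i+1} u_{2i}` and `v_{2i+1} v_{2i}` are pair related for all `i < ⌊d / 2⌋`. -/
def crossedCube (n : ℕ) : SimpleGraph (BitString n) where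
  Adj u v := ∃ d : Fin n,
    (∀ i : Fin n, d < i → u i = v i) ∧
    u d ≠ v d ∧
    (Odd (d : ℕ) → ∀ i : Fin n, (i : ℕ) + 1 = d → u i = v i) ∧
    ∀ i : ℕ, ∀ hi : i < (d : ℕ) / 2,
      PairRelated (u ⟨2 * i + 1, by omega⟩) (u ⟨2 * i, by omega⟩)
        (v ⟨2 * i + 1, by omega⟩) (v ⟨2 * i, by omega⟩)
  symm := ⟨by
    rintro u v ⟨d, h1, h2, h3, h4⟩
    exact ⟨d, fun i hi => (h1 i hi).symm, h2.symm, fun ho i hi => (h3 ho i hi).symm,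
      fun i hi => (h4 i hi).symm⟩⟩
  loopless := ⟨by
    rintro u ⟨d, -, h, -⟩
    exact h rfl⟩

/-- The positions flipped along the edge of dimension `d` at the vertex `u` of a Möbius cube:
`d` only if `u_{d+1} = 0`, and all of `d, d-1, …, 0` if `u_{d+1} = 1`; here `u_n` means `c`. -/
def mobiusFlips (c : Bool) (u : BitString n) (d : ℕ) : Set ℕ :=
  if bitD u c (d + 1) = true then Set.Iic d else {d}

theorem mem_mobiusFlips_self (c : Bool) (u : BitString n) (d : ℕ) : d ∈ mobiusFlips c u d := by
  unfold mobiusFlips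
  split <;> simp

theorem le_of_mem_mobiusFlips {c : Bool} {u : BitString n} {d i : ℕ}
    (h : i ∈ mobiusFlips c u d) : i ≤ d := by
  unfold mobiusFlips at h
  split at h
  · exact h
  · exact le_of_eq h

/-- The Möbius cubes of dimension `n`: the `0`-Möbius cube for `c = false` and the `1`-Möbius
cube for `c = true`. -/
def mobiusCube (c : Bool) (n : ℕ) : SimpleGraph (BitString n) where
  Adj u v := ∃ d : Fin n, DifferExactlyAt u v (mobiusFlips c u d)
  symm := ⟨by
    rintro u v ⟨d, h⟩
    refine ⟨d, ?_⟩
    have hp : bitD u c ((d : ℕ) + 1) = bitD v c ((d : ℕ) + 1) :=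
      h.bitD_eq c fun hmem => absurd (le_of_mem_mobiusFlips hmem) (by omega)
    have : mobiusFlips c v d = mobiusFlips c u d := by
      unfold mobiusFlips
      rw [hp]
    rw [this]
    exact h.symm⟩
  loopless := ⟨by
    rintro u ⟨d, h⟩
    exact DifferExactlyAt.not_self (d := d) (mem_mobiusFlips_self c u d) h⟩

open Classical in
/-- The positions flipped along the edge of dimension `d` at the vertex `u` of the locally twisted
cube: for `d ≥ 2` the bit `u_d` is complemented and `u_{d-1}` is replaced by `u_{d-1} ⊕ u_0`; for
`d ≤ 1` only the bit `u_d` is complemented. -/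
def locallyTwistedFlips (u : BitString n) (d : ℕ) : Set ℕ :=
  if 2 ≤ d ∧ bitD u false 0 = true then {d, d - 1} else {d}

theorem mem_locallyTwistedFlips_self (u : BitString n) (d : ℕ) :
    d ∈ locallyTwistedFlips u d := by
  unfold locallyTwistedFlips
  split <;> simp

/-- The locally twisted cube `LTQ_n`. -/
def locallyTwistedCube (n : ℕ) : SimpleGraph (BitString n) where
  Adj u v := ∃ d : Fin n, DifferExactlyAt u v (locallyTwistedFlips u d)
  symm := ⟨by
    rintro u v ⟨d, h⟩
    refine ⟨d, ?_⟩
    by_cases hd : 2 ≤ (d : ℕ)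
    · have hp : bitD u false 0 = bitD v false 0 := by
        refine h.bitD_eq false fun hmem => ?_
        unfold locallyTwistedFlips at hmem
        split at hmem
        · simp only [Set.mem_insert_iff, Set.mem_singleton_iff] at hmem
          omega
        · simp only [Set.mem_singleton_iff] at hmem
          omega
      have : locallyTwistedFlips v d = locallyTwistedFlips u d := by
        unfold locallyTwistedFlips
        rw [hp]
      rw [this]
      exact h.symm
    · have : locallyTwistedFlips v d = locallyTwistedFlips u d := by
        simp [locallyTwistedFlips, hd]
      rw [this]
      exact h.symm⟩
  loopless := ⟨by
    rintro u ⟨d, h⟩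
    exact DifferExactlyAt.not_self (d := d) (mem_locallyTwistedFlips_self u d) h⟩

end Cubes

end CubeNetworks

/-!
All these graphs are *layered cubes*: with the bits taken in a suitable order, the edge of dimension
`d` at `u` flips the bit `d`, fixes all higher bits and does something to the lower ones, so that
the graph is built from points by repeatedly joining two copies of half the size by a perfect
matching. Induction on this structure gives the edge-isoperimetric inequality
`|E(X)| ≥ k (n - log₂ k)` for every set `X` of `k` vertices (`IsLayeredCube.mul_sub_logb_le`); the
induction step, for halves of sizes `a ≤ c`, is the inequality
`a log a + c log c + 2 a log 2 ≤ (a + c) log (a + c)`, a form of Bernoulli's inequality. As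
`k (n - log₂ k)` is concave in `k`, for `n ≥ 5` every set `X` such that `X` and its complement have at
least `1`, `3` or `4` vertices has at least `n`, `3 n - 4` or `4 n - 8` boundary edges respectively.

This suffices, because of a general criterion (`isSuperExtra_of_lt`): a connected graph is
super-`λ^(h)` as soon as some connected set of `h + 1` vertices has a smaller boundary than every set
which, like its complement, has at least `h + 2` vertices. For `h = 2` one compares a path, with at
most `3 n - 4` boundary edges, with `4 n - 8`. For `h = 1`, after the deletion of a set `F` of at most
`n - 1` edges, sets with at least three vertices on both sides keep `3 n - 4 - |F|` boundary edges, while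
an edge at a vertex incident with `t` edges of `F` keeps at most `2 n - 2 - t`. The comparison is
immediate unless `F` is a matching of `n - 1` edges leaving a set of only three vertices, which is
impossible as `n - 1 > 3`. Deleting the `n` edges at a vertex disconnects the graph, so `n - 1` is the
maximum.
-/

namespace CubeNetworks

/-! ### Edge boundaries and components -/

section Boundary

variable {V : Type*}

theorem mk_mem_edgesLeaving {G : SimpleGraph V} {X : Set V} {x y : V} :
    s(x, y) ∈ edgesLeaving G X ↔ G.Adj x y ∧ ¬(x ∈ X ↔ y ∈ X) := by
  constructor
  · rintro ⟨a, ha, b, hb, hab, he⟩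
    rcases Sym2.eq_iff.1 he with ⟨rfl, rfl⟩ | ⟨rfl, rfl⟩
    · exact ⟨hab, by tauto⟩
    · exact ⟨hab.symm, by tauto⟩
  · rintro ⟨hxy, h⟩
    by_cases hx : x ∈ X
    · exact ⟨x, hx, y, by tauto, hxy, rfl⟩
    · exact ⟨y, by tauto, x, hx, hxy.symm, Sym2.eq_swap⟩

theorem edgesLeaving_subset_edgeSet (G : SimpleGraph V) (X : Set V) :
    edgesLeaving G X ⊆ G.edgeSet := by
  rintro e ⟨x, -, y, -, hxy, rfl⟩
  exact hxy

theorem edgesLeaving_compl (G : SimpleGraph V) (X : Set V) :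
    edgesLeaving G Xᶜ = edgesLeaving G X := by
  ext e
  induction e with
  | _ x y => simp only [mk_mem_edgesLeaving, Set.mem_compl_iff, not_iff_not]

theorem edgesLeaving_deleteEdges (G : SimpleGraph V) (F : Set (Sym2 V)) (X : Set V) :
    edgesLeaving (G.deleteEdges F) X = edgesLeaving G X \ F := by
  ext e
  induction e with
  | _ x y => simp only [mk_mem_edgesLeaving, SimpleGraph.deleteEdges_adj, Set.mem_sdiff]; tauto

theorem edgesLeaving_supp_subset {G : SimpleGraph V} {F : Set (Sym2 V)}
    (c : (G.deleteEdges F).ConnectedComponent) : edgesLeaving G c.supp ⊆ F := by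
  rintro e ⟨x, hx, y, hy, hxy, rfl⟩
  by_contra hF
  exact hy (c.mem_supp_of_adj_mem_supp hx (SimpleGraph.deleteEdges_adj.2 ⟨hxy, hF⟩))

/-- Edges joining a component of `G - E(Y)` to the rest of `G` all end in `Y`, so adding the
component to `Y` creates no new boundary edge. -/
theorem edgesLeaving_union_supp_subset {G : SimpleGraph V} {Y : Set V}
    (c : (G.deleteEdges (edgesLeaving G Y)).ConnectedComponent) :
    edgesLeaving G (Y ∪ c.supp) ⊆ edgesLeaving G Y := by
  rintro e ⟨x, hx, y, hy, hxy, rfl⟩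
  rcases hx with hx | hx
  · exact ⟨x, hx, y, fun h => hy (Or.inl h), hxy, rfl⟩
  · exact edgesLeaving_supp_subset c ⟨x, hx, y, fun h => hy (Or.inr h), hxy, rfl⟩

theorem mem_iff_of_reachable {G : SimpleGraph V} {Y : Set V} {x y : V}
    (h : (G.deleteEdges (edgesLeaving G Y)).Reachable x y) : x ∈ Y ↔ y ∈ Y := by
  obtain ⟨p⟩ := h
  induction p with
  | nil => rfl
  | cons hadj _ ih =>
    rw [SimpleGraph.deleteEdges_adj, mk_mem_edgesLeaving] at hadj
    tauto

theorem supp_eq_of_mem {G : SimpleGraph V} {Y : Set V} (hY : (G.induce Y).Connected)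
    (c : (G.deleteEdges (edgesLeaving G Y)).ConnectedComponent) {y : V} (hy : y ∈ Y)
    (hyc : y ∈ c.supp) : c.supp = Y := by
  ext z
  constructor
  · intro hz
    exact (mem_iff_of_reachable (c.reachable_of_mem_supp hyc hz)).1 hy
  · intro hz
    let f : G.induce Y →g G.deleteEdges (edgesLeaving G Y) :=
      ⟨Subtype.val, fun {a b} hab => by
        rw [SimpleGraph.deleteEdges_adj, mk_mem_edgesLeaving]
        exact ⟨hab, fun h => h.2 (by simp [a.2, b.2])⟩⟩
    have hr : (G.deleteEdges (edgesLeaving G Y)).Reachable y z :=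
      (hY.preconnected ⟨y, hy⟩ ⟨z, hz⟩).map f
    rw [SimpleGraph.ConnectedComponent.mem_supp_iff] at hyc ⊢
    rw [← hyc]
    exact SimpleGraph.ConnectedComponent.sound hr.symm

theorem connected_induce_supp {G : SimpleGraph V} {F : Set (Sym2 V)}
    (c : (G.deleteEdges F).ConnectedComponent) : (G.induce c.supp).Connected :=
  c.maximal_connected_induce_supp.prop.mono
    (SimpleGraph.comap_monotone _ (SimpleGraph.deleteEdges_le F))

theorem exists_component_ne {G : SimpleGraph V} [Nonempty V] (h : ¬ G.Connected)
    (c : G.ConnectedComponent) : ∃ c' : G.ConnectedComponent, c' ≠ c := by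
  by_contra! hall
  refine h ((SimpleGraph.connected_iff _).2 ⟨fun x y => ?_, inferInstance⟩)
  exact SimpleGraph.ConnectedComponent.exact ((hall _).trans (hall _).symm)

theorem connected_of_edgesLeaving_nonempty {G : SimpleGraph V} [Nonempty V]
    (h : ∀ X : Set V, X.Nonempty → X ≠ Set.univ → (edgesLeaving G X).Nonempty) :
    G.Connected := by
  by_contra hG
  obtain ⟨v⟩ := ‹Nonempty V›
  obtain ⟨c', hc'⟩ := exists_component_ne hG (G.connectedComponentMk v)
  obtain ⟨e, x, hx, y, hy, hxy, -⟩ := h c'.supp c'.nonempty_supp fun huniv => hc' <| by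
    have : v ∈ c'.supp := huniv ▸ Set.mem_univ v
    exact this.symm
  exact hy (c'.mem_supp_of_adj_mem_supp hx hxy)

open Classical in
/-- Counting the boundary edges of `X` by their ends in `X`. -/
theorem ncard_edgesLeaving [Fintype V] (G : SimpleGraph V) (X : Finset V) :
    (edgesLeaving G (X : Set V)).ncard = ∑ x ∈ X, (G.neighborFinset x \ X).card := by
  rw [← Finset.card_sigma, ← Set.ncard_coe_finset]
  symm
  refine Set.ncard_congr (fun p _ => s(p.1, p.2)) ?_ ?_ ?_
  · rintro ⟨x, y⟩ h
    simp only [Finset.coe_sigma, Set.mem_sigma_iff, Finset.mem_coe, Finset.mem_sdiff,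
      SimpleGraph.mem_neighborFinset] at h
    exact ⟨x, h.1, y, h.2.2, h.2.1, rfl⟩
  · rintro ⟨x, y⟩ ⟨x', y'⟩ h h' he
    simp only [Finset.coe_sigma, Set.mem_sigma_iff, Finset.mem_coe, Finset.mem_sdiff,
      SimpleGraph.mem_neighborFinset] at h h'
    rcases Sym2.eq_iff.1 he with ⟨h1, h2⟩ | ⟨h1, h2⟩
    · obtain rfl : x = x' := h1
      obtain rfl : y = y' := h2
      rfl
    · obtain rfl : x = y' := h1
      exact absurd h.1 h'.2.2
  · rintro e ⟨x, hx, y, hy, hxy, rfl⟩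
    exact ⟨⟨x, y⟩, by simpa using ⟨hx, hxy, hy⟩, rfl⟩

end Boundary

/-! ### A sufficient condition for being super-`λ^(h)` -/

section Sufficient

variable {V : Type*} [Fintype V] {H : SimpleGraph V} {h : ℕ}

theorem minExtraDegree_le {Y : Finset V} (hY : Y.card = h + 1)
    (hYc : (H.induce (Y : Set V)).Connected) :
    minExtraDegree H h ≤ (edgesLeaving H (Y : Set V)).ncard := by
  rw [(Set.toFinite _).cast_ncard_eq]
  exact iInf₂_le Y ⟨hY, hYc⟩

theorem exists_minExtraDegree_eq (hne : ∃ Y : Finset V, Y.card = h + 1 ∧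
    (H.induce (Y : Set V)).Connected) : ∃ Y : Finset V, Y.card = h + 1 ∧
    (H.induce (Y : Set V)).Connected ∧
      minExtraDegree H h = (edgesLeaving H (Y : Set V)).ncard := by
  obtain ⟨Y, ⟨hY, hYc⟩, hmin⟩ := Set.exists_min_image
    {Y : Finset V | Y.card = h + 1 ∧ (H.induce (Y : Set V)).Connected}
    (fun Y => (edgesLeaving H (Y : Set V)).ncard) (Set.toFinite _) hne
  refine ⟨Y, hY, hYc, le_antisymm (minExtraDegree_le hY hYc) (le_iInf₂ fun Z hZ => ?_)⟩
  rw [← (Set.toFinite (edgesLeaving H (Z : Set V))).cast_ncard_eq]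
  exact_mod_cast hmin Z hZ

open Classical in
/-- The edge boundary of a set attaining `ξ_h` is an `h`-extra edge-cut, provided that all larger
sets with large complement have a larger boundary: a component with at most `h` vertices could
be added to the set without enlarging its boundary. -/
theorem isExtraEdgeCut_edgesLeaving (hcard : 3 * h + 4 ≤ Fintype.card V) {Y : Finset V}
    (hY : Y.card = h + 1) (hYc : (H.induce (Y : Set V)).Connected)
    (hlt : ∀ X : Finset V, h + 2 ≤ X.card → X.card + (h + 2) ≤ Fintype.card V →
      (edgesLeaving H (Y : Set V)).ncard < (edgesLeaving H (X : Set V)).ncard) :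
    IsExtraEdgeCut H h (edgesLeaving H (Y : Set V)).toFinset := by
  refine ⟨by simpa using edgesLeaving_subset_edgeSet H _, ?_, ?_⟩
  · rw [Set.coe_toFinset]
    intro hcon
    obtain ⟨y, hy⟩ := Finset.card_pos.1 (show 0 < Y.card by omega)
    have huniv : Y = Finset.univ := Finset.eq_univ_of_forall fun z =>
      (mem_iff_of_reachable (hcon.preconnected y z)).1 hy
    rw [huniv, Finset.card_univ] at hY
    omega
  · rw [Set.coe_toFinset]
    intro c
    rw [← (Set.toFinite c.supp).cast_ncard_eq]
    norm_cast
    by_cases hYmem : ∃ y ∈ (Y : Set V), y ∈ c.supp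
    · obtain ⟨y, hy, hyc⟩ := hYmem
      rw [supp_eq_of_mem hYc c hy hyc, Set.ncard_coe_finset]
      omega
    · push Not at hYmem
      by_contra! hsmall
      have hpos : 0 < c.supp.ncard := (Set.ncard_pos).2 c.nonempty_supp
      have hU : (Y ∪ c.supp.toFinset).card = h + 1 + c.supp.ncard := by
        rw [Finset.card_union_of_disjoint, hY, Set.ncard_eq_toFinset_card']
        exact Finset.disjoint_left.2 fun y hy hyc => hYmem y hy (by simpa using hyc)
      have hgt := hlt (Y ∪ c.supp.toFinset) (by omega) (by omega)
      refine absurd (Set.ncard_le_ncard (edgesLeaving_union_supp_subset c) (Set.toFinite _)) ?_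
      rw [Finset.coe_union, Set.coe_toFinset] at hgt
      omega

open Classical in
/-- If some connected set of `h + 1` vertices has a smaller boundary than every set for which
both it and its complement have at least `h + 2` vertices, then the graph is super-`λ^(h)`. -/
theorem isSuperExtra_of_lt (hH : H.Connected) (hcard : 3 * h + 4 ≤ Fintype.card V)
    (hlt : ∀ X : Finset V, h + 2 ≤ X.card → X.card + (h + 2) ≤ Fintype.card V →
      ∃ Y : Finset V, Y.card = h + 1 ∧ (H.induce (Y : Set V)).Connected ∧
        (edgesLeaving H (Y : Set V)).ncard < (edgesLeaving H (X : Set V)).ncard) :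
    IsSuperExtra H h := by
  have : Nonempty V := hH.nonempty
  have hne : ∃ Y : Finset V, Y.card = h + 1 ∧ (H.induce (Y : Set V)).Connected := by
    obtain ⟨X, -, hX⟩ := Finset.exists_subset_card_eq
      (show h + 2 ≤ (Finset.univ : Finset V).card by rw [Finset.card_univ]; omega)
    obtain ⟨Y, h1, h2, -⟩ := hlt X (by omega) (by omega)
    exact ⟨Y, h1, h2⟩
  obtain ⟨Y, hY, hYc, hYmin⟩ := exists_minExtraDegree_eq hne
  have hltY : ∀ X : Finset V, h + 2 ≤ X.card → X.card + (h + 2) ≤ Fintype.card V →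
      (edgesLeaving H (Y : Set V)).ncard < (edgesLeaving H (X : Set V)).ncard := by
    intro X h1 h2
    obtain ⟨Z, hZ, hZc, hZX⟩ := hlt X h1 h2
    refine lt_of_le_of_lt ?_ hZX
    have := minExtraDegree_le hZ hZc
    rw [hYmin] at this
    exact_mod_cast this
  have hcut := isExtraEdgeCut_edgesLeaving hcard hY hYc hltY
  have key : ∀ F : Finset (Sym2 V), IsExtraEdgeCut H h F →
      (edgesLeaving H (Y : Set V)).ncard ≤ F.card ∧
      (F.card ≤ (edgesLeaving H (Y : Set V)).ncard →
        ∃ c : (H.deleteEdges (F : Set (Sym2 V))).ConnectedComponent,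
          c.supp.encard = (h + 1 : ℕ)) := by
    rintro F ⟨-, hdis, hbig⟩
    have hbig' : ∀ c : (H.deleteEdges (F : Set (Sym2 V))).ConnectedComponent,
        h < c.supp.ncard := by
      intro c
      have := hbig c
      rw [← (Set.toFinite c.supp).cast_ncard_eq] at this
      exact_mod_cast this
    have hle : ∀ c : (H.deleteEdges (F : Set (Sym2 V))).ConnectedComponent,
        (edgesLeaving H c.supp).ncard ≤ F.card := by
      intro c
      rw [← Set.ncard_coe_finset F]
      exact Set.ncard_le_ncard (edgesLeaving_supp_subset c) (Set.toFinite _)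
    have hsmall : ∀ c : (H.deleteEdges (F : Set (Sym2 V))).ConnectedComponent,
        c.supp.ncard = h + 1 → (edgesLeaving H (Y : Set V)).ncard ≤ F.card ∧
          c.supp.encard = (h + 1 : ℕ) := by
      intro c hc
      refine ⟨le_trans ?_ (hle c), by rw [← (Set.toFinite c.supp).cast_ncard_eq, hc]⟩
      have := minExtraDegree_le (H := H) (h := h) (Y := c.supp.toFinset)
        (by rw [← Set.ncard_eq_toFinset_card', hc])
        (by rw [Set.coe_toFinset]; exact connected_induce_supp c)
      rw [hYmin, Set.coe_toFinset] at this
      exact_mod_cast this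
    obtain ⟨v⟩ := ‹Nonempty V›
    obtain ⟨c, hc⟩ : ∃ c, c = (H.deleteEdges (F : Set (Sym2 V))).connectedComponentMk v :=
      ⟨_, rfl⟩
    obtain ⟨c', hc'⟩ := exists_component_ne hdis c
    have hsum : c.supp.ncard + c'.supp.ncard ≤ Fintype.card V := by
      rw [← Set.ncard_union_eq (SimpleGraph.pairwise_disjoint_supp_connectedComponent _ hc'.symm)
        (Set.toFinite _) (Set.toFinite _), ← Nat.card_eq_fintype_card]
      exact Set.ncard_le_card _
    have h1 := hbig' c
    have h2 := hbig' c'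
    by_cases e1 : c.supp.ncard = h + 1
    · exact ⟨(hsmall c e1).1, fun _ => ⟨c, (hsmall c e1).2⟩⟩
    by_cases e2 : c'.supp.ncard = h + 1
    · exact ⟨(hsmall c' e2).1, fun _ => ⟨c', (hsmall c' e2).2⟩⟩
    have hcc : c.supp.toFinset.card = c.supp.ncard := (Set.ncard_eq_toFinset_card' _).symm
    have := hltY c.supp.toFinset (by omega) (by omega)
    rw [Set.coe_toFinset] at this
    have := hle c
    exact ⟨by omega, fun _ => by omega⟩
  have hconn : extraEdgeConnectivity H h = (edgesLeaving H (Y : Set V)).ncard := by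
    refine le_antisymm ?_ (le_iInf₂ fun F hF => by exact_mod_cast (key F hF).1)
    refine (iInf₂_le _ hcut).trans ?_
    rw [Set.ncard_eq_toFinset_card']
  refine ⟨hH, ⟨by rw [hconn]; exact ENat.natCast_ne_top _, by rw [hconn, hYmin]⟩, ?_⟩
  intro F hF hFc
  refine (key F hF).2 ?_
  rw [hconn] at hFc
  exact le_of_eq (by exact_mod_cast hFc)

end Sufficient

/-! ### The edge-isoperimetric inequality for layered cubes -/

section Layered

/-- `G` is an `n`-dimensional layered cube: its vertices are coordinatized by the bits `b 0 u`, …,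
`b (n-1) u`, and the neighbours of `u` are `nb 0 u`, …, `nb (n-1) u`, where `nb d` flips the bit
`d`, preserves all higher bits and does anything to the lower ones. Thus fixing the bits `≥ d + 1`
gives a subgraph consisting of two `d`-dimensional layered cubes joined by the perfect matching
`nb d`. -/
structure IsLayeredCube {V : Type*} (G : SimpleGraph V) (n : ℕ) (b : Fin n → V → Bool)
    (nb : Fin n → V → V) : Prop where
  ext_bits : ∀ u v, (∀ i, b i u = b i v) → u = v
  flip : ∀ d u, b d (nb d u) = !b d u
  above : ∀ d i, d < i → ∀ u, b i (nb d u) = b i u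
  adj_iff : ∀ u v, G.Adj u v ↔ ∃ d, v = nb d u

variable {V : Type*} {G : SimpleGraph V} {n : ℕ} {b : Fin n → V → Bool} {nb : Fin n → V → V}

namespace IsLayeredCube

/-- The dimension of an edge is the highest bit in which its ends differ. -/
theorem dim_eq (hG : IsLayeredCube G n b nb) {d e : Fin n} {u v : V}
    (h : v = nb d u) (h' : v = nb e u ∨ u = nb e v) : d = e := by
  have key : ∀ i, b i v ≠ b i u → i ≤ e := by
    intro i hi
    by_contra! hlt
    rcases h' with rfl | h'
    · exact hi (hG.above e i hlt u)
    · exact hi (by conv_rhs => rw [h', hG.above e i hlt v])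
  have h1 : d ≤ e := key d (by rw [h, hG.flip]; simp)
  refine le_antisymm h1 (not_lt.1 fun hlt => ?_)
  have h2 : b e v = b e u := by rw [h, hG.above d e hlt]
  rcases h' with rfl | h'
  · rw [hG.flip] at h2; simp at h2
  · rw [h', hG.flip] at h2; simp at h2

theorem involutive (hG : IsLayeredCube G n b nb) (d : Fin n) (u : V) : nb d (nb d u) = u := by
  have h : G.Adj (nb d u) u := ((hG.adj_iff u (nb d u)).2 ⟨d, rfl⟩).symm
  obtain ⟨e, he⟩ := (hG.adj_iff _ _).1 h
  obtain rfl := hG.dim_eq (rfl : nb d u = nb d u) (Or.inr he)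
  exact he.symm

variable [Fintype V]

open Classical in
theorem neighborFinset_eq (hG : IsLayeredCube G n b nb) (u : V) :
    G.neighborFinset u = Finset.univ.image fun d => nb d u := by
  ext v
  simp [hG.adj_iff, eq_comm]

open Classical in
theorem card_neighborFinset (hG : IsLayeredCube G n b nb) (u : V) :
    (G.neighborFinset u).card = n := by
  rw [hG.neighborFinset_eq, Finset.card_image_of_injective, Finset.card_univ, Fintype.card_fin]
  intro d e h
  exact hG.dim_eq rfl (Or.inl h)

open Classical in
theorem ncard_edgesLeaving_eq_sum (hG : IsLayeredCube G n b nb) (X : Finset V) :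
    (edgesLeaving G (X : Set V)).ncard = ∑ d, (X.filter fun u => nb d u ∉ X).card := by
  have h : ∀ u, (G.neighborFinset u \ X).card =
      (Finset.univ.filter fun d => nb d u ∉ X).card := by
    intro u
    rw [hG.neighborFinset_eq, ← Finset.filter_notMem_eq_sdiff, Finset.filter_image,
      Finset.card_image_of_injective]
    intro d e h
    exact hG.dim_eq rfl (Or.inl h)
  simp only [ncard_edgesLeaving, h, Finset.card_filter]
  exact Finset.sum_comm

end IsLayeredCube

/-- Superadditivity of `k ↦ k log k` with the gain `2 a log 2`; by Bernoulli's inequality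
`(1 + a / b) ^ (b / a) ≥ 2`. -/
theorem mul_log_add_mul_log_le {a c : ℝ} (ha : 0 ≤ a) (hac : a ≤ c) :
    a * Real.log a + c * Real.log c + 2 * a * Real.log 2 ≤ (a + c) * Real.log (a + c) := by
  rcases ha.eq_or_lt with rfl | ha
  · simp
  have hc : 0 < c := ha.trans_le hac
  have h1 : Real.log 2 + Real.log a ≤ Real.log (a + c) := by
    rw [← Real.log_mul (by norm_num) ha.ne']
    exact Real.log_le_log (by positivity) (by linarith)
  have h2 : a * Real.log 2 ≤ c * (Real.log (a + c) - Real.log c) := by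
    have hB : (2 : ℝ) ≤ (1 + a / c) ^ (c / a) := by
      have := one_add_mul_self_le_rpow_one_add (s := a / c) (by have : 0 < a / c := by positivity
                                                                linarith)
        (p := c / a) (by rwa [le_div_iff₀ ha, one_mul])
      rwa [show 1 + c / a * (a / c) = 2 by field_simp; norm_num] at this
    have hL := Real.log_le_log (by norm_num) hB
    rw [Real.log_rpow (by positivity), show 1 + a / c = (a + c) / c by field_simp; ring,
      Real.log_div (by positivity) hc.ne', div_mul_eq_mul_div, le_div_iff₀ ha] at hL
    linarith
  nlinarith

/-- The same inequality in base `2` and without the assumption on the order. -/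
theorem mul_logb_add_mul_logb_le {a c : ℝ} (ha : 0 ≤ a) (hc : 0 ≤ c) :
    a * Real.logb 2 a + c * Real.logb 2 c + 2 * min a c ≤ (a + c) * Real.logb 2 (a + c) := by
  wlog hac : a ≤ c generalizing a c
  · have := this hc ha (le_of_not_ge hac)
    rw [min_comm, add_comm a c]
    linarith
  have h2 : 0 < Real.log 2 := Real.log_pos (by norm_num)
  have h := div_le_div_of_nonneg_right (mul_log_add_mul_log_le ha hac) h2.le
  rw [min_eq_left hac]
  simp only [Real.logb]
  calc _ = _ := ?_
    _ ≤ _ := h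
    _ = _ := by ring
  field_simp

open Classical in
/-- The isoperimetric inequality inside the subcubes obtained by fixing the bits `≥ j`, where only
boundary edges of dimension `< j` are counted. The set `X` splits by its bit `j` into parts of
sizes `a` and `c`, and the matching `nb j` contributes at least `|a - c|` boundary edges. -/
theorem IsLayeredCube.mul_sub_logb_le_sum (hG : IsLayeredCube G n b nb) :
    ∀ j ≤ n, ∀ X : Finset V, (∀ u ∈ X, ∀ v ∈ X, ∀ i : Fin n, j ≤ i → b i u = b i v) →
      (X.card : ℝ) * (j - Real.logb 2 X.card) ≤
        ∑ d ∈ Finset.univ.filter (fun d : Fin n => (d : ℕ) < j),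
          ((X.filter fun u => nb d u ∉ X).card : ℝ) := by
  intro j
  induction j with
  | zero =>
    intro _ X hX
    have hle : X.card ≤ 1 := Finset.card_le_one.2 fun u hu v hv =>
      hG.ext_bits u v fun i => hX u hu v hv i (Nat.zero_le _)
    interval_cases h : X.card <;> simp
  | succ j ih =>
    intro hj X hX
    let k : Fin n := ⟨j, hj⟩
    let P : Bool → Finset V := fun t => X.filter fun u => b k u = t
    have hPX : ∀ t u, u ∈ P t ↔ u ∈ X ∧ b k u = t := by simp [P]
    have hP : ∀ t, ((P t).card : ℝ) * (j - Real.logb 2 (P t).card) ≤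
        ∑ d ∈ Finset.univ.filter (fun d : Fin n => (d : ℕ) < j),
          (((P t).filter fun u => nb d u ∉ P t).card : ℝ) := by
      intro t
      refine ih (by omega) (P t) fun u hu v hv i hi => ?_
      rw [hPX] at hu hv
      rcases hi.eq_or_lt with hi | hi
      · obtain rfl : k = i := Fin.ext hi
        rw [hu.2, hv.2]
      · exact hX u hu.1 v hv.1 i hi
    have hsplit : ∀ (p : V → Prop) [DecidablePred p], ((X.filter p).card : ℝ) =
        ((P true).filter p).card + ((P false).filter p).card := by
      intro p _
      rw [← Finset.card_filter_add_card_filter_not (s := X.filter p) (fun u => b k u = true)]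
      push_cast
      simp only [P, Finset.filter_filter, Bool.not_eq_true]
      simp only [and_comm]
    have hcard : (X.card : ℝ) = (P true).card + (P false).card := by
      simpa using hsplit fun _ => True
    -- Along a dimension below `j` the bit `j` is preserved.
    have hlow : ∀ d : Fin n, (d : ℕ) < j → ((X.filter fun u => nb d u ∉ X).card : ℝ) =
        ((P true).filter fun u => nb d u ∉ P true).card +
          ((P false).filter fun u => nb d u ∉ P false).card := by
      intro d hd
      rw [hsplit]
      congr 3 <;>
      · refine Finset.filter_congr fun u hu => ?_
        rw [hPX] at hu
        rw [hPX, hG.above d k hd, hu.2]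
        simp
    have hmatch : ∀ t, ((P t).card : ℝ) - (P !t).card ≤
        ((P t).filter fun u => nb k u ∉ X).card := by
      intro t
      have hinj : ((P t).filter fun u => nb k u ∈ X).card ≤ (P !t).card := by
        refine Finset.card_le_card_of_injOn (nb k) (fun u hu => ?_) fun u _ v _ h => ?_
        · rw [Finset.mem_coe, Finset.mem_filter, hPX] at hu
          rw [Finset.mem_coe, hPX, hG.flip, hu.1.2]
          exact ⟨hu.2, rfl⟩
        · rw [← hG.involutive k u, h, hG.involutive]
      have := Finset.card_filter_add_card_filter_not (s := P t) (fun u => nb k u ∈ X)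
      have h' : ((P t).card : ℝ) = ((P t).filter fun u => nb k u ∈ X).card +
        ((P t).filter fun u => nb k u ∉ X).card := by exact_mod_cast this.symm
      have : (((P t).filter fun u => nb k u ∈ X).card : ℝ) ≤ (P !t).card := by
        exact_mod_cast hinj
      linarith
    have hset : (Finset.univ.filter fun d : Fin n => (d : ℕ) < j + 1) =
        insert k (Finset.univ.filter fun d : Fin n => (d : ℕ) < j) := by
      ext d
      simp only [Finset.mem_filter, Finset.mem_univ, true_and, Finset.mem_insert, k, Fin.ext_iff]
      omega
    rw [hset, Finset.sum_insert (by simp [k]), hsplit (fun u => nb k u ∉ X),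
      Finset.sum_congr rfl fun d hd => hlow d (Finset.mem_filter.1 hd).2,
      Finset.sum_add_distrib, hcard]
    have e1 := hP true
    have e2 := hP false
    have e3 := hmatch true
    have e4 := hmatch false
    simp only [Bool.not_true, Bool.not_false] at e3 e4
    have e5 := mul_logb_add_mul_logb_le (a := (P true).card) (c := (P false).card)
      (Nat.cast_nonneg _) (Nat.cast_nonneg _)
    have p1 : (0 : ℝ) ≤ ((P true).filter fun u => nb k u ∉ X).card := Nat.cast_nonneg _
    have p2 : (0 : ℝ) ≤ ((P false).filter fun u => nb k u ∉ X).card := Nat.cast_nonneg _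
    push_cast
    rcases le_total ((P true).card : ℝ) ((P false).card : ℝ) with h | h
    · rw [min_eq_left h] at e5
      linarith
    · rw [min_eq_right h] at e5
      linarith

variable [Fintype V]

/-- A set of `k` vertices of an `n`-dimensional layered cube has at least `k (n - log₂ k)`
boundary edges. -/
theorem IsLayeredCube.mul_sub_logb_le (hG : IsLayeredCube G n b nb) (X : Finset V) :
    (X.card : ℝ) * (n - Real.logb 2 X.card) ≤ (edgesLeaving G (X : Set V)).ncard := by
  classical
  have := hG.mul_sub_logb_le_sum n le_rfl X fun u _ v _ i hi => absurd i.2 (by omega)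
  rw [hG.ncard_edgesLeaving_eq_sum]
  push_cast
  simpa using this

theorem concaveOn_mul_sub_logb (n : ℕ) :
    ConcaveOn ℝ (Set.Ici 0) fun x : ℝ => x * (n - Real.logb 2 x) := by
  have h1 : ConcaveOn ℝ (Set.Ici (0 : ℝ)) fun x : ℝ => (1 / Real.log 2) * Real.negMulLog x :=
    Real.concaveOn_negMulLog.smul (by positivity)
  have h2 : ConcaveOn ℝ (Set.Ici (0 : ℝ)) fun x : ℝ => (n : ℝ) * x :=
    (concaveOn_id (convex_Ici 0)).smul (Nat.cast_nonneg n)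
  refine (h2.add h1).congr fun x _ => ?_
  simp only [Real.logb, Real.negMulLog, Pi.add_apply]
  ring

/-- By concavity, the isoperimetric bound on the sizes `2 ^ s ≤ |X| ≤ 2 ^ (n - 1)` is smallest at
one of the two ends; larger sets are replaced by their complements. -/
theorem IsLayeredCube.min_le_ncard_edgesLeaving (hG : IsLayeredCube G n b nb)
    (hV : Fintype.card V = 2 ^ n) (hn : 1 ≤ n) (s : ℕ) (X : Finset V) (h1 : 2 ^ s ≤ X.card)
    (h2 : X.card + 2 ^ s ≤ 2 ^ n) :
    min ((2 : ℝ) ^ s * (n - s)) (2 ^ (n - 1)) ≤ (edgesLeaving G (X : Set V)).ncard := by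
  classical
  obtain ⟨m, rfl⟩ : ∃ m, n = m + 1 := ⟨n - 1, by omega⟩
  wlog hle : X.card ≤ 2 ^ m generalizing X
  · have hc : Xᶜ.card = 2 ^ (m + 1) - X.card := by rw [Finset.card_compl, hV]
    rw [pow_succ] at hc h2
    have := this Xᶜ (by omega) (by rw [pow_succ]; omega) (by omega)
    rwa [Finset.coe_compl, edgesLeaving_compl] at this
  refine le_trans ?_ (hG.mul_sub_logb_le X)
  have h1' : (2 : ℝ) ^ s ≤ X.card := by exact_mod_cast h1
  have hle' : (X.card : ℝ) ≤ 2 ^ m := by exact_mod_cast hle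
  have := (concaveOn_mul_sub_logb (m + 1)).min_le_of_mem_Icc (x := 2 ^ s) (y := 2 ^ m)
    (z := (X.card : ℝ)) (Set.mem_Ici.2 (by positivity)) (Set.mem_Ici.2 (by positivity))
    ⟨h1', hle'⟩
  simpa [Real.logb_pow] using this

theorem four_mul_le_two_pow {m : ℕ} (hm : 4 ≤ m) : 4 * m ≤ 2 ^ m := by
  induction m, hm using Nat.le_induction with
  | base => norm_num
  | succ m hm ih => rw [pow_succ]; omega

theorem IsLayeredCube.le_ncard_edgesLeaving (hG : IsLayeredCube G n b nb)
    (hV : Fintype.card V = 2 ^ n) (hn : 5 ≤ n) {X : Finset V} (h1 : 1 ≤ X.card)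
    (h2 : X.card + 1 ≤ 2 ^ n) : n ≤ (edgesLeaving G (X : Set V)).ncard := by
  have h := hG.min_le_ncard_edgesLeaving hV (by omega) 0 X (by simpa using h1) (by simpa using h2)
  have hp : (4 : ℝ) * (n - 1 : ℕ) ≤ 2 ^ (n - 1) := by
    exact_mod_cast four_mul_le_two_pow (by omega)
  have hn' : (5 : ℝ) ≤ n := by exact_mod_cast hn
  push_cast [show 1 ≤ n by omega] at hp
  rw [min_eq_left (by norm_num; linarith)] at h
  norm_num at h
  exact h

theorem IsLayeredCube.four_mul_le_ncard_edgesLeaving (hG : IsLayeredCube G n b nb)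
    (hV : Fintype.card V = 2 ^ n) (hn : 5 ≤ n) {X : Finset V} (h1 : 4 ≤ X.card)
    (h2 : X.card + 4 ≤ 2 ^ n) : 4 * n ≤ (edgesLeaving G (X : Set V)).ncard + 8 := by
  have h := hG.min_le_ncard_edgesLeaving hV (by omega) 2 X (by simpa using h1) (by simpa using h2)
  have hp : (4 : ℝ) * (n - 1 : ℕ) ≤ 2 ^ (n - 1) := by
    exact_mod_cast four_mul_le_two_pow (by omega)
  push_cast [show 1 ≤ n by omega] at hp
  rw [min_eq_left (by norm_num; linarith)] at h
  norm_num at h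
  have : (4 * n : ℝ) ≤ (edgesLeaving G (X : Set V)).ncard + 8 := by linarith
  exact_mod_cast this

theorem IsLayeredCube.three_mul_le_ncard_edgesLeaving_of_card_eq (hG : IsLayeredCube G n b nb)
    {X : Finset V} (h1 : X.card = 3) : 3 * n ≤ (edgesLeaving G (X : Set V)).ncard + 4 := by
  have h := hG.mul_sub_logb_le X
  rw [h1] at h
  -- Three vertices span fewer than `5 / 2` edges, because `3 ^ 3 < 2 ^ 5`.
  have hlog : 3 * Real.logb 2 3 < 5 := by
    have h2 : Real.logb 2 (3 ^ 3) < Real.logb 2 (2 ^ 5) :=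
      Real.logb_lt_logb (by norm_num) (by norm_num) (by norm_num)
    simpa [Real.logb_pow] using h2
  have : (3 * n : ℝ) < (edgesLeaving G (X : Set V)).ncard + 4 + 1 := by
    push_cast at h
    linarith
  exact Nat.lt_succ_iff.1 (by exact_mod_cast this)

theorem IsLayeredCube.three_mul_le_ncard_edgesLeaving (hG : IsLayeredCube G n b nb)
    (hV : Fintype.card V = 2 ^ n) (hn : 5 ≤ n) {X : Finset V} (h1 : 3 ≤ X.card)
    (h2 : X.card + 3 ≤ 2 ^ n) : 3 * n ≤ (edgesLeaving G (X : Set V)).ncard + 4 := by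
  classical
  by_cases h3 : X.card = 3
  · exact hG.three_mul_le_ncard_edgesLeaving_of_card_eq h3
  by_cases h4 : X.card + 3 = 2 ^ n
  · have := hG.three_mul_le_ncard_edgesLeaving_of_card_eq (X := Xᶜ)
      (by rw [Finset.card_compl, hV]; omega)
    rwa [Finset.coe_compl, edgesLeaving_compl] at this
  · have := hG.four_mul_le_ncard_edgesLeaving hV hn (X := X) (by omega) (by omega)
    omega

end Layered

/-! ### Super-connectivity and persistence of layered cubes -/

section Persistence

variable {V : Type*}

/-- If more edges leave a set than the set has vertices, then two of the edges share an end. -/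
theorem exists_common_vertex {G : SimpleGraph V} {F : Finset (Sym2 V)}
    {X : Finset V} (hX : X.card < F.card)
    (hF : (F : Set (Sym2 V)) ⊆ edgesLeaving G (X : Set V)) :
    ∃ e ∈ F, ∃ e' ∈ F, e ≠ e' ∧ ∃ x, x ∈ e ∧ x ∈ e' := by
  have h : ∀ e ∈ F, ∃ x ∈ X, x ∈ e := by
    intro e he
    obtain ⟨x, hx, y, -, -, rfl⟩ := hF he
    exact ⟨x, hx, Sym2.mem_mk_left x y⟩
  choose f hf using h
  obtain ⟨e, -, e', -, hne, heq⟩ := Finset.exists_ne_map_eq_of_card_lt_of_maps_to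
    (s := F.attach) (t := X) (f := fun e => f e.1 e.2) (by simpa using hX)
    fun e _ => (hf e.1 e.2).1
  exact ⟨e, e.2, e', e'.2, fun h => hne (Subtype.ext h), f e e.2, (hf e e.2).2,
    (congrArg (· ∈ e'.1) heq).mpr (hf e' e'.2).2⟩

variable [Fintype V]

open Classical in
/-- A non-isolated vertex `x` forms together with any neighbour a connected pair with at most
`deg x + (maximum degree) - 2` boundary edges. -/
theorem exists_pair_ncard_edgesLeaving_le {H : SimpleGraph V} {n m : ℕ} {x : V}
    (hdeg : ∀ z, (H.neighborFinset z).card ≤ n) (hx : (H.neighborFinset x).card ≤ m)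
    (hne : ∃ z, H.Adj x z) :
    ∃ Y : Finset V, Y.card = 2 ∧ (H.induce (Y : Set V)).Connected ∧
      (edgesLeaving H (Y : Set V)).ncard + 2 ≤ m + n := by
  obtain ⟨z, hz⟩ := hne
  refine ⟨{x, z}, Finset.card_pair hz.ne, ?_, ?_⟩
  · rw [Finset.coe_pair]
    exact SimpleGraph.induce_pair_connected_of_adj hz
  · rw [ncard_edgesLeaving, Finset.sum_pair hz.ne]
    have h1 : (H.neighborFinset x \ {x, z}).card < (H.neighborFinset x).card :=
      Finset.card_lt_card ⟨Finset.sdiff_subset, fun h => by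
        simpa using h ((H.mem_neighborFinset x z).2 hz)⟩
    have h2 : (H.neighborFinset z \ {x, z}).card < (H.neighborFinset z).card :=
      Finset.card_lt_card ⟨Finset.sdiff_subset, fun h => by
        simpa using h ((H.mem_neighborFinset z x).2 hz.symm)⟩
    have := hdeg z
    omega

namespace IsLayeredCube

variable {G : SimpleGraph V} {n : ℕ} {b : Fin n → V → Bool} {nb : Fin n → V → V}

open Classical in
theorem exists_path_ncard_edgesLeaving_le (hG : IsLayeredCube G n b nb) [Nonempty V]
    (hn : 2 ≤ n) : ∃ Y : Finset V, Y.card = 3 ∧ (G.induce (Y : Set V)).Connected ∧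
      (edgesLeaving G (Y : Set V)).ncard + 4 ≤ 3 * n := by
  obtain ⟨v⟩ := ‹Nonempty V›
  obtain ⟨u, hu, w, hw, huw⟩ := Finset.one_lt_card.1
    (show 1 < (G.neighborFinset v).card by rw [hG.card_neighborFinset]; omega)
  rw [SimpleGraph.mem_neighborFinset] at hu hw
  have hcard : ({u, v, w} : Finset V).card = 3 :=
    Finset.card_eq_three.2 ⟨u, v, w, hu.ne', huw, hw.ne, rfl⟩
  refine ⟨{u, v, w}, hcard, ?_, ?_⟩
  · have := SimpleGraph.induce_union_connected
      (SimpleGraph.induce_pair_connected_of_adj hu.symm).preconnected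
      (SimpleGraph.induce_pair_connected_of_adj hw).preconnected ⟨v, by simp⟩
    rw [show ((({u, v, w} : Finset V)) : Set V) = {u, v} ∪ {v, w} by ext z; simp; tauto]
    exact this
  · rw [ncard_edgesLeaving, Finset.sum_insert (by simp [hu.ne', huw]), Finset.sum_pair hw.ne]
    have key : ∀ x (S : Finset V), (∀ z ∈ S, G.Adj x z) → S ⊆ {u, v, w} →
        (G.neighborFinset x \ {u, v, w}).card + S.card ≤ n := by
      intro x S hS hsub
      rw [← hG.card_neighborFinset x, ← Finset.card_union_of_disjoint
        (Finset.disjoint_left.2 fun z hz hzS => (Finset.mem_sdiff.1 hz).2 (hsub hzS))]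
      refine Finset.card_le_card (Finset.union_subset Finset.sdiff_subset fun z hz => ?_)
      exact (G.mem_neighborFinset x z).2 (hS z hz)
    have h1 := key u {v} (by simp [hu.symm]) (by intro z; simp; tauto)
    have h2 := key v {u, w} (by simp [hu, hw]) (by intro z; simp; tauto)
    have h3 := key w {v} (by simp [hw.symm]) (by intro z; simp; tauto)
    rw [Finset.card_pair huw] at h2
    rw [Finset.card_singleton] at h1 h3
    omega

open Classical in
theorem connected_deleteEdges (hG : IsLayeredCube G n b nb) (hV : Fintype.card V = 2 ^ n)
    (hn : 5 ≤ n) {F : Finset (Sym2 V)} (hF : F.card < n) :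
    (G.deleteEdges (F : Set (Sym2 V))).Connected := by
  have : Nonempty V := Fintype.card_pos_iff.1 (by rw [hV]; positivity)
  refine connected_of_edgesLeaving_nonempty fun X hX hX' => ?_
  rw [edgesLeaving_deleteEdges, Set.sdiff_nonempty]
  intro hsub
  have hc : X.toFinset.card ≠ 0 := by simpa [Set.Nonempty] using hX
  have hc' : X.toFinset.card < Fintype.card V :=
    (Finset.card_lt_iff_ne_univ _).2 (by simpa using hX')
  have h1 := hG.le_ncard_edgesLeaving hV hn (X := X.toFinset) (by omega) (by omega)
  have h2 := Set.ncard_le_ncard hsub (Set.toFinite _)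
  rw [Set.coe_toFinset] at h1
  rw [Set.ncard_coe_finset] at h2
  omega

theorem isSuperExtra_two (hG : IsLayeredCube G n b nb) (hV : Fintype.card V = 2 ^ n)
    (hn : 5 ≤ n) : IsSuperExtra G 2 := by
  have : Nonempty V := Fintype.card_pos_iff.1 (by rw [hV]; positivity)
  have hpow : 2 ^ 5 ≤ 2 ^ n := Nat.pow_le_pow_right (by norm_num) hn
  have hcon : G.Connected := by
    simpa using hG.connected_deleteEdges hV hn (F := ∅) (by simp; omega)
  refine isSuperExtra_of_lt hcon (by omega) fun X h1 h2 => ?_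
  obtain ⟨Y, hY, hYc, hYb⟩ := hG.exists_path_ncard_edgesLeaving_le (by omega)
  have := hG.four_mul_le_ncard_edgesLeaving hV hn h1 (by omega)
  exact ⟨Y, hY, hYc, by omega⟩

open Classical in
/-- If the connected spanning subgraph `H` lacks the edges from `x` to `S`, then every edge of `H` at
`x` has at most `2 n - 2 - |S|` boundary edges in `H`. -/
theorem exists_pair_of_le (hG : IsLayeredCube G n b nb) [Nontrivial V] {H : SimpleGraph V}
    (hle : H ≤ G) (hcon : H.Connected) {x : V} {S : Finset V}
    (hS : ∀ y ∈ S, G.Adj x y ∧ ¬ H.Adj x y) :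
    ∃ Y : Finset V, Y.card = 2 ∧ (H.induce (Y : Set V)).Connected ∧
      (edgesLeaving H (Y : Set V)).ncard + 2 ≤ n - S.card + n := by
  have hsub : ∀ z, H.neighborFinset z ⊆ G.neighborFinset z := fun z y hy => by
    rw [SimpleGraph.mem_neighborFinset] at hy ⊢
    exact hle hy
  refine exists_pair_ncard_edgesLeaving_le (x := x)
    (fun z => (Finset.card_le_card (hsub z)).trans_eq (hG.card_neighborFinset z)) ?_
    (hcon.preconnected.exists_adj_of_nontrivial x)
  have hdisj : Disjoint (H.neighborFinset x) S := Finset.disjoint_left.2 fun y hy hyS =>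
    (hS y hyS).2 ((H.mem_neighborFinset x y).1 hy)
  have := Finset.card_le_card (Finset.union_subset (hsub x) fun y hy =>
    (G.mem_neighborFinset x y).2 (hS y hy).1)
  rw [Finset.card_union_of_disjoint hdisj, hG.card_neighborFinset] at this
  omega

open Classical in
/-- Deleting fewer than `n` edges. A set `X` as in the sufficient condition keeps at least
`3 n - 4 - |F|` boundary edges, which has to be compared with the `2 n - 2 - t` boundary edges of
an edge whose ends are incident with `t` deleted edges. -/
theorem isSuperExtra_one_deleteEdges (hG : IsLayeredCube G n b nb)
    (hV : Fintype.card V = 2 ^ n) (hn : 5 ≤ n) {F : Finset (Sym2 V)}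
    (hFG : (F : Set (Sym2 V)) ⊆ G.edgeSet) (hF : F.card < n) :
    IsSuperExtra (G.deleteEdges (F : Set (Sym2 V))) 1 := by
  have hpow : 2 ^ 5 ≤ 2 ^ n := Nat.pow_le_pow_right (by norm_num) hn
  have hcon := hG.connected_deleteEdges hV hn hF
  have : Nonempty V := hcon.nonempty
  have : Nontrivial V := Fintype.one_lt_card_iff_nontrivial.1 (by omega)
  have hpair : ∀ x, ∀ S : Finset V, (∀ y ∈ S, s(x, y) ∈ F) →
      ∃ Y : Finset V, Y.card = 2 ∧
        ((G.deleteEdges (F : Set (Sym2 V))).induce (Y : Set V)).Connected ∧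
        (edgesLeaving (G.deleteEdges (F : Set (Sym2 V))) (Y : Set V)).ncard + 2 ≤
          n - S.card + n := fun x S hS =>
    hG.exists_pair_of_le (SimpleGraph.deleteEdges_le _) hcon fun y hy =>
      ⟨hFG (hS y hy), fun h => (SimpleGraph.deleteEdges_adj.1 h).2 (hS y hy)⟩
  refine isSuperExtra_of_lt hcon (by omega) fun X h1 h2 => ?_
  have hX := hG.three_mul_le_ncard_edgesLeaving hV hn h1 (by omega)
  have hsplit : (edgesLeaving G (X : Set V)).ncard =
      (edgesLeaving (G.deleteEdges (F : Set (Sym2 V))) (X : Set V)).ncard +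
        (edgesLeaving G (X : Set V) ∩ F).ncard := by
    rw [edgesLeaving_deleteEdges, add_comm,
      Set.ncard_inter_add_ncard_sdiff_eq_ncard _ _ (Set.toFinite _)]
  have hinter : (edgesLeaving G (X : Set V) ∩ F).ncard ≤ F.card := by
    rw [← Set.ncard_coe_finset F]
    exact Set.ncard_le_ncard Set.inter_subset_right (Set.toFinite _)
  by_cases htwo : ∃ e ∈ F, ∃ e' ∈ F, e ≠ e' ∧ ∃ x, x ∈ e ∧ x ∈ e'
  · -- The ends of an edge at `x` are incident with two deleted edges.
    obtain ⟨e, he, e', he', hne, x, ⟨y, rfl⟩, ⟨y', rfl⟩⟩ := htwo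
    obtain ⟨Y, hY, hYc, hYb⟩ := hpair x {y, y'} (by simpa using ⟨he, he'⟩)
    rw [Finset.card_pair (by rintro rfl; exact hne rfl)] at hYb
    exact ⟨Y, hY, hYc, by omega⟩
  rcases F.eq_empty_or_nonempty with rfl | ⟨e, he⟩
  · obtain ⟨x⟩ := ‹Nonempty V›
    obtain ⟨Y, hY, hYc, hYb⟩ := hpair x ∅ (by simp)
    simp only [Finset.card_empty] at hYb hinter
    exact ⟨Y, hY, hYc, by omega⟩
  induction e with
  | _ x y =>
  obtain ⟨Y, hY, hYc, hYb⟩ := hpair x {y} (by simpa using he)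
  rw [Finset.card_singleton] at hYb
  refine ⟨Y, hY, hYc, ?_⟩
  by_contra! hle
  -- Otherwise all bounds are attained: `|F| = n - 1 ≥ 4`, the edges of `F` all leave `X`, and `X` or
  -- its complement has three vertices, so that two edges of `F` meet.
  have hFX : (F : Set (Sym2 V)) ⊆ edgesLeaving G (X : Set V) := by
    have : edgesLeaving G (X : Set V) ∩ F = F := by
      refine Set.eq_of_subset_of_ncard_le Set.inter_subset_right ?_ (Set.toFinite _)
      rw [Set.ncard_coe_finset]
      omega
    exact Set.inter_eq_right.1 this
  rcases eq_or_ne X.card 3 with h3 | h3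
  · exact htwo (exists_common_vertex (by omega) hFX)
  rcases eq_or_ne (X.card + 3) (2 ^ n) with h4 | h4
  · refine htwo (exists_common_vertex (G := G) (X := Xᶜ) ?_ ?_)
    · rw [Finset.card_compl]
      omega
    · rwa [Finset.coe_compl, edgesLeaving_compl]
  · have := hG.four_mul_le_ncard_edgesLeaving hV hn (X := X) (by omega) (by omega)
    omega

theorem hasPersistence (hG : IsLayeredCube G n b nb) (hV : Fintype.card V = 2 ^ n)
    (hn : 5 ≤ n) : HasPersistence G 1 (n - 1) := by
  classical
  refine ⟨fun F hFG hF => hG.isSuperExtra_one_deleteEdges hV hn hFG (by omega), fun m hm => ?_⟩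
  -- Deleting all `n` edges at a vertex disconnects the graph.
  by_contra! hlt
  obtain ⟨v⟩ : Nonempty V := Fintype.card_pos_iff.1 (by rw [hV]; positivity)
  have hpow : 2 ^ 5 ≤ 2 ^ n := Nat.pow_le_pow_right (by norm_num) hn
  have : Nontrivial V := Fintype.one_lt_card_iff_nontrivial.1 (by omega)
  have hcard : (G.incidenceFinset v).card = n := by
    rw [G.card_incidenceFinset_eq_degree, SimpleGraph.degree, ← hG.card_neighborFinset v]
  have hcon := (hm (G.incidenceFinset v)
    (by rw [SimpleGraph.coe_incidenceFinset]; exact G.incidenceSet_subset v) (by omega)).1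
  obtain ⟨z, hz⟩ := hcon.preconnected.exists_adj_of_nontrivial v
  rw [SimpleGraph.deleteEdges_adj, SimpleGraph.coe_incidenceFinset] at hz
  exact hz.2 ⟨hz.1, Sym2.mem_mk_left v z⟩

end IsLayeredCube

end Persistence

/-! ### The five families are layered cubes -/

section Families

variable {n : ℕ}

open Classical in
/-- The string obtained from `u` by complementing the bits in positions belonging to `S`. -/
noncomputable def flipBits (u : BitString n) (S : Set ℕ) : BitString n :=
  fun i => if (i : ℕ) ∈ S then !u i else u i

theorem differExactlyAt_iff {u v : BitString n} {S : Set ℕ} :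
    DifferExactlyAt u v S ↔ v = flipBits u S := by
  simp only [DifferExactlyAt, funext_iff, flipBits]
  refine forall_congr' fun i => ?_
  by_cases hi : (i : ℕ) ∈ S <;> cases u i <;> cases v i <;> simp [hi]

/-- A graph on bit strings whose edges flip the positions `flips u d` is a layered cube if the
positions can be ordered, by `σ`, so that the highest position in `flips u d` is always `d`. -/
theorem isLayeredCube_of_flips {G : SimpleGraph (BitString n)} (σ : Equiv.Perm (Fin n))
    (flips : BitString n → ℕ → Set ℕ)
    (hadj : ∀ u v, G.Adj u v ↔ ∃ d : Fin n, DifferExactlyAt u v (flips u d))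
    (hself : ∀ u (d : Fin n), (d : ℕ) ∈ flips u d)
    (habove : ∀ u (d i : Fin n), d < i → (σ i : ℕ) ∉ flips u (σ d)) :
    IsLayeredCube G n (fun i u => u (σ i)) (fun d u => flipBits u (flips u (σ d))) where
  ext_bits u v h := funext fun i => by simpa using h (σ.symm i)
  flip d u := by simp [flipBits, hself]
  above d i hi u := by simp [flipBits, habove u d i hi]
  adj_iff u v := by
    rw [hadj]
    simp only [differExactlyAt_iff]
    exact ⟨fun ⟨d, hd⟩ => ⟨σ.symm d, by simpa using hd⟩, fun ⟨d, hd⟩ => ⟨σ d, hd⟩⟩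

theorem isLayeredCube_hypercube : ∃ b nb, IsLayeredCube (hypercube n) n b nb := by
  refine ⟨_, _, isLayeredCube_of_flips (Equiv.refl _) (fun _ d => {d}) (fun _ _ => Iff.rfl)
    (fun _ _ => rfl) fun u d i hi => ?_⟩
  simp only [Equiv.refl_apply, Set.mem_singleton_iff]
  omega

/-- The involution of the positions of the twisted cube that swaps `d` and `d + 1` for odd `d` with
`d + 1 < n`. -/
def twistedSwap (n i : ℕ) : ℕ :=
  if i % 2 = 1 then (if i + 1 < n then i + 1 else i) else i - 1

theorem twistedSwap_lt {i : ℕ} (hi : i < n) : twistedSwap n i < n := by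
  unfold twistedSwap
  split_ifs <;> omega

theorem twistedSwap_twistedSwap {i : ℕ} (hi : i < n) : twistedSwap n (twistedSwap n i) = i := by
  unfold twistedSwap
  split_ifs <;> omega

/-- The order of the positions in the twisted cube: an edge of odd dimension `d` may flip the bit
`d + 1`, so `d` has to come after `d + 1`. -/
def twistedOrder (n : ℕ) : Equiv.Perm (Fin n) :=
  Function.Involutive.toPerm (fun i => ⟨twistedSwap n i, twistedSwap_lt i.2⟩) fun i =>
    Fin.ext (twistedSwap_twistedSwap i.2)

theorem isLayeredCube_twistedCube : ∃ b nb, IsLayeredCube (twistedCube n) n b nb := by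
  refine ⟨_, _, isLayeredCube_of_flips (twistedOrder n) twistedFlips (fun _ _ => Iff.rfl)
    (fun u d => mem_twistedFlips_self u d) fun u d i hi hmem => ?_⟩
  have hval : ∀ k : Fin n, (twistedOrder n k : ℕ) = twistedSwap n k := fun _ => rfl
  have h : (twistedOrder n i : ℕ) = twistedOrder n d ∨
      (twistedOrder n d : ℕ) % 2 = 1 ∧ (twistedOrder n i : ℕ) = twistedOrder n d + 1 := by
    unfold twistedFlips at hmem
    split at hmem
    · rename_i hodd
      rcases hmem with h | h
      · exact Or.inl h
      · exact Or.inr ⟨Nat.odd_iff.1 hodd.1, h⟩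
    · exact Or.inl hmem
  rw [hval, hval] at h
  unfold twistedSwap at h
  have := i.2
  have : (d : ℕ) < i := hi
  split_ifs at h <;> omega

theorem isLayeredCube_mobiusCube (c : Bool) : ∃ b nb, IsLayeredCube (mobiusCube c n) n b nb := by
  refine ⟨_, _, isLayeredCube_of_flips (Equiv.refl _) (mobiusFlips c) (fun _ _ => Iff.rfl)
    (fun u d => mem_mobiusFlips_self c u d) fun u d i hi hmem => ?_⟩
  exact absurd (le_of_mem_mobiusFlips hmem) (not_le.2 hi)

theorem isLayeredCube_locallyTwistedCube :
    ∃ b nb, IsLayeredCube (locallyTwistedCube n) n b nb := by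
  refine ⟨_, _, isLayeredCube_of_flips (Equiv.refl _) locallyTwistedFlips (fun _ _ => Iff.rfl)
    (fun u d => mem_locallyTwistedFlips_self u d) fun u d i hi hmem => ?_⟩
  have : (d : ℕ) < i := hi
  unfold locallyTwistedFlips at hmem
  split at hmem
  · rcases hmem with h | h <;> simp only [Equiv.refl_apply, Set.mem_singleton_iff] at h <;> omega
  · simp only [Equiv.refl_apply, Set.mem_singleton_iff] at hmem
    omega

theorem pairRelated_iff {x₁ x₀ y₁ y₀ : Bool} :
    PairRelated x₁ x₀ y₁ y₀ ↔ x₀ = y₀ ∧ (x₁ ≠ y₁ ↔ x₀ = true) := by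
  cases x₁ <;> cases x₀ <;> cases y₁ <;> cases y₀ <;> simp [PairRelated]

/-- The positions flipped along the edge of dimension `d` at the vertex `u` of the crossed cube:
`d`, and the upper position of each pair `2 i + 1, 2 i` below `d` with `u_{2i} = 1`. -/
def crossedFlips (u : BitString n) (d : ℕ) : Set ℕ :=
  {k | k = d ∨ ∃ i < d / 2, k = 2 * i + 1 ∧ bitD u false (2 * i) = true}

theorem crossedCube_adj_iff (u v : BitString n) :
    (crossedCube n).Adj u v ↔ ∃ d : Fin n, DifferExactlyAt u v (crossedFlips u d) := by
  refine exists_congr fun d => ?_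
  simp only [pairRelated_iff]
  have hbit : ∀ i (hi : i < n), bitD u false i = u ⟨i, hi⟩ := fun i hi => by simp [bitD, hi]
  constructor
  · rintro ⟨h1, h2, h3, h4⟩ k
    rcases lt_trichotomy d k with hk | rfl | hk
    · have : (d : ℕ) < k := hk
      refine iff_of_false (not_not.2 (h1 k hk)) ?_
      rintro (h | ⟨i, hi, h, -⟩) <;> omega
    · exact iff_of_true h2 (Or.inl rfl)
    · have hk' : (k : ℕ) < d := hk
      rcases Nat.even_or_odd' (k : ℕ) with ⟨i, hi | hi⟩
      · have heq : u k = v k := by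
          by_cases hid : i < (d : ℕ) / 2
          · have := (h4 i hid).1
            rwa [show (⟨2 * i, _⟩ : Fin n) = k from Fin.ext hi.symm] at this
          · exact h3 (Nat.odd_iff.2 (by omega)) k (by omega)
        refine iff_of_false (not_not.2 heq) ?_
        rintro (h | ⟨j, hj, h, -⟩) <;> omega
      · have := (h4 i (by omega)).2
        rw [show (⟨2 * i + 1, _⟩ : Fin n) = k from Fin.ext hi.symm] at this
        rw [this, ← hbit]
        constructor
        · intro h
          exact Or.inr ⟨i, by omega, hi, h⟩
        · rintro (h | ⟨j, hj, h, hb⟩)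
          · omega
          · rwa [show i = j by omega]
  · intro h
    refine ⟨fun i hi => ?_, (h d).2 (Or.inl rfl), fun hodd i hi => ?_, fun i hi => ⟨?_, ?_⟩⟩
    · have : (d : ℕ) < i := hi
      refine h.eq_of_not_mem ?_
      rintro (h | ⟨i, hi, h, -⟩) <;> omega
    · rw [Nat.odd_iff] at hodd
      refine h.eq_of_not_mem ?_
      rintro (h | ⟨i, hi, h, -⟩) <;> omega
    · refine h.eq_of_not_mem ?_
      dsimp only
      rintro (h | ⟨i, hi, h, -⟩) <;> omega
    · rw [h, ← hbit]
      constructor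
      · rintro (h | ⟨j, hj, h, hb⟩)
        · dsimp only at h
          omega
        · rwa [show i = j by simpa using h]
      · intro hb
        exact Or.inr ⟨i, hi, rfl, hb⟩

theorem isLayeredCube_crossedCube : ∃ b nb, IsLayeredCube (crossedCube n) n b nb := by
  refine ⟨_, _, isLayeredCube_of_flips (Equiv.refl _) crossedFlips crossedCube_adj_iff
    (fun u d => Or.inl rfl) fun u d i hi hmem => ?_⟩
  have : (d : ℕ) < i := hi
  simp only [Equiv.refl_apply] at hmem
  rcases hmem with h | ⟨j, hj, h, -⟩ <;> omega

end Families

end CubeNetworks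

theorem corollary4p5 (n : ℕ) (hn : 5 ≤ n)
    (G : SimpleGraph (CubeNetworks.BitString n))
    (hG : G = CubeNetworks.hypercube n ∨ G = CubeNetworks.twistedCube n ∨
      G = CubeNetworks.crossedCube n ∨ (∃ c : Bool, G = CubeNetworks.mobiusCube c n) ∨
      G = CubeNetworks.locallyTwistedCube n) :
    CubeNetworks.IsSuperExtra G 2 ∧ CubeNetworks.IsSuperExtra G 1 ∧
      CubeNetworks.HasPersistence G 1 (n - 1) := by
  have key : ∃ b nb, CubeNetworks.IsLayeredCube G n b nb := by
    rcases hG with rfl | rfl | rfl | ⟨c, rfl⟩ | rfl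
    · exact CubeNetworks.isLayeredCube_hypercube
    · exact CubeNetworks.isLayeredCube_twistedCube
    · exact CubeNetworks.isLayeredCube_crossedCube
    · exact CubeNetworks.isLayeredCube_mobiusCube c
    · exact CubeNetworks.isLayeredCube_locallyTwistedCube
  obtain ⟨b, nb, h⟩ := key
  have hV : Fintype.card (CubeNetworks.BitString n) = 2 ^ n := by simp
  refine ⟨h.isSuperExtra_two hV hn, ?_, h.hasPersistence hV hn⟩
  simpa using h.isSuperExtra_one_deleteEdges hV hn (F := ∅) (by simp) (by simp; omega)
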